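/- Let $n$ be a natural number, let $\Omega_n=\{-1,1\}^n$ carry its uniform probability $\mathbb P$, with expectation $\mathbb E$, and let $f:\Omega_n\to\mathbb C$. For $1\le j\le n$ put $(\partial_j f)(x)=f(x)-f(xe_j)$, where $xe_j$ is $x$ with its $j$-th coordinate multiplied by $-1$; let $|\nabla f|=\big(\sum_{j=1}^n|\partial_j f|^2\big)^{1/2}$, let $\|\,|\nabla f|\,\|_\infty=\max_{x\in\Omega_n}|\nabla f|(x)$, and let $\Delta=\sum_{j=1}^n\partial_j^2$. With the Walsh functions $\omega_A(x)=\prod_{j\in A}x_j$, $A\subseteq\{1,\dots,n\}$, one has $\Delta\omega_A=4|A|\,\omega_A$; for $\alpha>0$ define $\Delta^\alpha f=\sum_{A}(4|A|)^\alpha\,\mathbb E[f\omega_A]\,\omega_A$. 1. For every $t>0$, $$\mathbb P\{|f-\mathbb Ef|>t\}\le 2\exp\Big(-\frac{8t^2}{\pi^2\,\|\,|\nabla f|\,\|_\infty^2}\Big).$$ 2. Let $0<\alpha<\frac12$ and let $$K_\alpha=\frac1{\Gamma(1-\alpha)}\int_0^{\pi/2}(-\log\cos\theta)^{-\alpha}\,d\theta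 .$$ Then the integral converges, $0<K_\alpha<\infty$, and for every $t>0$, $$\mathbb P\{|\Delta^\alpha f|>t\}\le 2\exp\Big(-\frac{t^2}{2K_\alpha^2\,\|\,|\nabla f|\,\|_\infty^2}\Big).$$ If $\|\,|\nabla f|\,\|_\infty=0$, the right-hand sides are read as $0$, that is, both probabilities vanish. -/

import Mathlib

open MeasureTheory ProbabilityTheory

noncomputable section

namespace DiscreteCube

/-- The discrete cube `{-1, 1}ⁿ` with its coordinatewise product; `ℤˣ = {1, -1}`. -/
abbrev Cube (n : ℕ) : Type := Fin n → ℤˣ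

/-- The measurable structure of `{1, -1}` is the discrete one. -/
instance : MeasurableSingletonClass ℤˣ where
  measurableSet_singleton u := by
    have h : ({u} : Set ℤˣ) = Units.val ⁻¹' {(u : ℤ)} := by
      ext v
      simp [Units.ext_iff]
    rw [h]
    exact ⟨_, measurableSet_singleton _, rfl⟩

/-- The uniform probability on the cube. -/
def prob (n : ℕ) : Measure (Cube n) := uniformOn (Set.univ : Set (Cube n))

/-- The expectation of a complex function for the uniform probability. -/
def expect {n : ℕ} (f : Cube n → ℂ) : ℂ := ∫ x, f x ∂(prob n)

/-- The point `e_j = (1, …, -1, …, 1)` of the cube, with `-1` at coordinate `j`. -/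
def signFlip {n : ℕ} (j : Fin n) : Cube n := Function.update 1 j (-1)

/-- The discrete partial derivative `(∂_j f)(x) = f(x) - f(x e_j)`. -/
def partialDeriv {n : ℕ} (j : Fin n) (f : Cube n → ℂ) : Cube n → ℂ :=
  fun x => f x - f (x * signFlip j)

/-- The length of the discrete gradient, `|∇f| = (∑_j |∂_j f|²)^{1/2}`. -/
def gradLength {n : ℕ} (f : Cube n → ℂ) : Cube n → ℝ :=
  fun x => Real.sqrt (∑ j, ‖partialDeriv j f x‖ ^ 2)

/-- The sup norm `‖ |∇f| ‖_∞`. The cube is finite and non-empty, so this is a maximum. -/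
def gradSup {n : ℕ} (f : Cube n → ℂ) : ℝ := ⨆ x, gradLength f x

/-- The discrete Laplacian `Δ = ∑_j ∂_j²`. -/
def laplacian {n : ℕ} (f : Cube n → ℂ) : Cube n → ℂ :=
  ∑ j, partialDeriv j (partialDeriv j f)

/-- The Walsh function `ω_A = ∏_{j ∈ A} ω_j`, where `ω_j` is the `j`-th coordinate function. -/
def walsh {n : ℕ} (A : Finset (Fin n)) : Cube n → ℂ :=
  fun x => ∏ j ∈ A, (((x j : ℤˣ) : ℤ) : ℂ)

/-- The Walsh coefficient of `f` at `A`, the expectation of `f ω_A`. -/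
def walshCoeff {n : ℕ} (f : Cube n → ℂ) (A : Finset (Fin n)) : ℂ :=
  expect (fun x => f x * walsh A x)

/-- The power `Δ^α`, `α > 0`, of the Laplacian, in the sense of the functional calculus: the Walsh
functions form an orthonormal basis of `L²` and `Δ ω_A = 4 |A| ω_A` (`laplacian_walsh` below), so
`Δ^α f = ∑_A (4 |A|)^α (walshCoeff f A) ω_A`. -/
def laplacianPow {n : ℕ} (α : ℝ) (f : Cube n → ℂ) : Cube n → ℂ :=
  fun x => ∑ A : Finset (Fin n),
    (((4 * (A.card : ℝ)) ^ α : ℝ) : ℂ) * walshCoeff f A * walsh A x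

/-- The function `θ ↦ (-log cos θ)^{-α}`, considered on `[0, π/2]`. -/
def logCosPow (α θ : ℝ) : ℝ := (-Real.log (Real.cos θ)) ^ (-α)

/-- `K_α = Γ(1 - α)⁻¹ ‖(-log cos θ)^{-α}‖_{L¹([0, π/2])}`. -/
def constK (α : ℝ) : ℝ :=
  1 / Real.Gamma (1 - α) * ∫ θ in Set.Icc 0 (Real.pi / 2), |logCosPow α θ|

theorem walsh_mul_signFlip {n : ℕ} (A : Finset (Fin n)) (j : Fin n) (x : Cube n) :
    walsh A (x * signFlip j) = if j ∈ A then -walsh A x else walsh A x := by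
  unfold walsh signFlip
  have h : ∀ i, ((((x * (Function.update 1 j (-1) : Cube n)) i : ℤˣ) : ℤ) : ℂ)
      = (((x i : ℤˣ) : ℤ) : ℂ) * (if j = i then -1 else 1) := by
    intro i
    by_cases hij : j = i
    · subst hij; simp
    · simp [hij, Function.update_of_ne (Ne.symm hij)]
  simp only [h, Finset.prod_mul_distrib, Finset.prod_ite_eq]
  split_ifs <;> simp

/-- The Walsh functions are eigenvectors of the Laplacian, `Δ ω_A = 4 |A| ω_A`. -/
theorem laplacian_walsh {n : ℕ} (A : Finset (Fin n)) (x : Cube n) :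
    laplacian (walsh A) x = 4 * (A.card : ℂ) * walsh A x := by
  have h : ∀ j, partialDeriv j (partialDeriv j (walsh A)) x
      = if j ∈ A then 4 * walsh A x else 0 := by
    intro j
    simp only [partialDeriv, walsh_mul_signFlip]
    split_ifs <;> ring
  simp only [laplacian, Finset.sum_apply, h, Finset.sum_ite_mem, Finset.univ_inter,
    Finset.sum_const, nsmul_eq_mul]
  ring

end DiscreteCube

end

open DiscreteCube

namespace DiscreteCube

open Matrix
open scoped ComplexOrder

/-! Let `T_c` multiply `ω_A` by `c^|A|`, and let `H_θ = -(d/dθ) T_{cos θ} f`. Both functions in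
question are integrals of `H_θ` over `[0, π/2]`: `f - 𝔼f` with weight `1`, and `Δ^α f` with weight
`4^α Γ(1-α)⁻¹ (-log cos θ)^{-α}`. Since `cosh` is convex, it suffices to bound the `cosh` moments of
`|H_θ|` uniformly in `θ`.

The point is that `H_θ(x)` is a diagonal entry of `R M Rᴴ` (`rotation_sum_flipMatrix_apply`). Here
`R` is unitary, a tensor power of the rotation of angle `θ/2`, and `M = ∑ j, flipMatrix f j` does
not depend on `θ`. The even moments of the diagonal are at most `tr (M Mᴴ)^k`, where `R` has
disappeared, and this is at most `tr A^{2k}` for the matrix `A = ∑ j, absFlipMatrix f j`, which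
dominates `M` entrywise (`sum_norm_diag_pow_le`).

Each summand `B_j` of `A` has diagonal square `|∂_j f|²/4`, and conjugation by multiplication by
`x_j` changes the sign of `B_j` and fixes the other summands. This gives `tr A^{2k+2} ≤ (2k+1) v tr
A^{2k}` with `v = ‖|∇f|‖_∞²/4` (`trace_pow_add_two_le`), the moment recursion of a centred Gaussian
of variance `v`. Averaging multiplies the standard deviation by the total weight
(`sum_cosh_multiplier_le`), and Chernoff's bound concludes (`prob_tail_le`). -/

/-! ### Trace inequalities for a matrix and its conjugate by a symmetry -/

theorem pow_mul_pow_add_le (a b : ℝ) {i m k : ℕ} (h : i + m = 2 * k) :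
    a ^ i * b ^ m + a ^ m * b ^ i ≤ a ^ (2 * k) + b ^ (2 * k) := by
  have key : ∀ x y : ℝ, 0 ≤ x → 0 ≤ y →
      x ^ i * y ^ m + x ^ m * y ^ i ≤ x ^ (2 * k) + y ^ (2 * k) := by
    intro x y hx hy
    -- For nonnegative `x`, `y` the difference of the two sides is `(x^i - y^i)(x^m - y^m)`, whose
    -- factors have the same sign.
    rw [← h, pow_add, pow_add]
    rcases le_total x y with hxy | hxy
    · nlinarith [mul_nonneg (sub_nonneg.2 (pow_le_pow_left₀ hx hxy i))
        (sub_nonneg.2 (pow_le_pow_left₀ hx hxy m))]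
    · nlinarith [mul_nonneg (sub_nonneg.2 (pow_le_pow_left₀ hy hxy i))
        (sub_nonneg.2 (pow_le_pow_left₀ hy hxy m))]
  have h1 : a ^ i * b ^ m ≤ |a| ^ i * |b| ^ m := by
    rw [← abs_pow, ← abs_pow, ← abs_mul]; exact le_abs_self _
  have h2 : a ^ m * b ^ i ≤ |a| ^ m * |b| ^ i := by
    rw [← abs_pow, ← abs_pow, ← abs_mul]; exact le_abs_self _
  have h3 := key |a| |b| (abs_nonneg _) (abs_nonneg _)
  rw [(even_two_mul k).pow_abs, (even_two_mul k).pow_abs] at h3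
  linarith

/-- The geometric sum for `(a^{2k+1} - b^{2k+1})/(a - b)` has `2k+1` terms; added to its reversal,
it splits into pairs, each at most `a^{2k} + b^{2k}`. -/
theorem sub_mul_pow_sub_pow_le (a b : ℝ) (k : ℕ) :
    2 * ((a - b) * (a ^ (2 * k + 1) - b ^ (2 * k + 1)))
      ≤ (2 * k + 1) * ((a - b) ^ 2 * (a ^ (2 * k) + b ^ (2 * k))) := by
  have hg := geom_sum₂_mul a b (2 * k + 1)
  set S := ∑ i ∈ Finset.range (2 * k + 1), a ^ i * b ^ (2 * k + 1 - 1 - i) with hS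
  have hr : S = ∑ i ∈ Finset.range (2 * k + 1), a ^ (2 * k + 1 - 1 - i) * b ^ i := by
    rw [hS, ← Finset.sum_range_reflect]
    refine Finset.sum_congr rfl fun i hi => ?_
    have := Finset.mem_range.1 hi
    congr 2
    omega
  have h2 : 2 * S ≤ (2 * k + 1) * (a ^ (2 * k) + b ^ (2 * k)) := by
    calc 2 * S = S + S := by ring
      _ = ∑ i ∈ Finset.range (2 * k + 1),
          (a ^ i * b ^ (2 * k + 1 - 1 - i) + a ^ (2 * k + 1 - 1 - i) * b ^ i) := by
        rw [Finset.sum_add_distrib, ← hr]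
      _ ≤ ∑ i ∈ Finset.range (2 * k + 1), (a ^ (2 * k) + b ^ (2 * k)) := by
        refine Finset.sum_le_sum fun i hi => ?_
        have := Finset.mem_range.1 hi
        exact pow_mul_pow_add_le a b (by omega)
      _ = _ := by simp; ring
  rw [← hg]
  nlinarith [mul_le_mul_of_nonneg_left h2 (sq_nonneg (a - b))]

variable {ι : Type*} [Fintype ι] [DecidableEq ι]

/-- In an eigenbasis of `A`, the weight `W r s` is the square of the `(r, s)` entry of `S`. Traces
mixing `A` with its conjugate thus become sums over pairs of eigenvalues, to which scalar
inequalities apply. -/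
theorem trace_pow_mul_conj_pow {A S : Matrix ι ι ℝ} (hA : A.IsHermitian) (hS : S.IsHermitian) :
    ∃ (μ : ι → ℝ) (W : ι → ι → ℝ), (∀ r s, 0 ≤ W r s) ∧ (∀ r s, W r s = W s r) ∧
      ∀ a b : ℕ, (A ^ a * (S * A ^ b * S)).trace = ∑ r, ∑ s, W r s * (μ r ^ a * μ s ^ b) := by
  set O : Matrix ι ι ℝ := (hA.eigenvectorUnitary : Matrix ι ι ℝ) with hO
  set μ := hA.eigenvalues with hμ
  have hO1 : Oᴴ * O = 1 := by
    have := hA.eigenvectorUnitary.2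
    exact (Unitary.mem_iff.1 this).1
  have hAd : A = O * diagonal μ * Oᴴ := by
    have := hA.spectral_theorem
    rw [Unitary.conjStarAlgAut_apply] at this
    exact this
  have hpow : ∀ a : ℕ, A ^ a = O * diagonal (fun r => μ r ^ a) * Oᴴ := by
    intro a
    induction a with
    | zero =>
      have : O * Oᴴ = 1 := mul_eq_one_comm.1 hO1
      simp only [pow_zero, diagonal_one, Matrix.mul_one, this]
    | succ a ih =>
      rw [pow_succ, ih]
      nth_rewrite 1 [hAd]
      calc O * diagonal (fun r => μ r ^ a) * Oᴴ * (O * diagonal μ * Oᴴ)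
          = O * diagonal (fun r => μ r ^ a) * (Oᴴ * O) * diagonal μ * Oᴴ := by
            simp only [Matrix.mul_assoc]
        _ = _ := by
            rw [hO1, Matrix.mul_one, Matrix.mul_assoc O, diagonal_mul_diagonal]
            simp only [pow_succ]
  set V := Oᴴ * S * O with hV
  have hVs : ∀ r s, V r s = V s r := by
    intro r s
    have : Vᴴ = V := by
      rw [hV]
      simp only [conjTranspose_mul, conjTranspose_conjTranspose, hS.eq, Matrix.mul_assoc]
    have h2 := congrFun (congrFun this s) r
    simpa [conjTranspose_apply] using h2
  refine ⟨μ, fun r s => V r s ^ 2, fun r s => sq_nonneg _, fun r s => congrArg (· ^ 2) (hVs r s), ?_⟩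
  intro a b
  have : (A ^ a * (S * A ^ b * S)).trace
      = (diagonal (fun r => μ r ^ a) * V * diagonal (fun r => μ r ^ b) * V).trace := by
    rw [hpow, hpow, hV]
    have e1 : O * diagonal (fun r => μ r ^ a) * Oᴴ * (S * (O * diagonal (fun r => μ r ^ b) * Oᴴ) * S)
      = O * (diagonal (fun r => μ r ^ a) * Oᴴ * S * O * diagonal (fun r => μ r ^ b) * Oᴴ * S) := by
      simp only [Matrix.mul_assoc]
    rw [e1, trace_mul_comm]
    simp only [Matrix.mul_assoc]
  rw [this, trace]
  refine Finset.sum_congr rfl fun r _ => ?_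
  rw [diag_apply, mul_apply]
  refine Finset.sum_congr rfl fun s _ => ?_
  rw [mul_diagonal, diagonal_mul, hVs s r]
  ring

/-- Both traces are sums over eigenvalue pairs with symmetric weights; after symmetrizing in the
pair, the claim is `sub_mul_pow_sub_pow_le` term by term. -/
theorem two_mul_trace_pow_mul_sub_conj_le {A S : Matrix ι ι ℝ} (hA : A.IsHermitian)
    (hS : S.IsHermitian) (hS1 : S * S = 1) (k : ℕ) :
    2 * (A ^ (2 * k + 1) * (A - S * A * S)).trace
      ≤ (2 * k + 1) * (A ^ (2 * k) * ((A - S * A * S) * (A - S * A * S))).trace := by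
  obtain ⟨μ, W, hW, hWs, h⟩ := trace_pow_mul_conj_pow hA hS
  have hsymm : ∀ g : ι → ι → ℝ, ∑ r, ∑ s, W r s * g r s = ∑ r, ∑ s, W r s * g s r := by
    intro g
    rw [Finset.sum_comm]
    exact Finset.sum_congr rfl fun r _ => Finset.sum_congr rfl fun s _ => by rw [hWs]
  have e1 : (A ^ (2 * k + 1) * (A - S * A * S)).trace
      = ∑ r, ∑ s, W r s * (μ r ^ (2 * k + 2) - μ r ^ (2 * k + 1) * μ s) := by
    have h1 := h (2 * k + 2) 0
    have h2 := h (2 * k + 1) 1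
    simp only [pow_zero, hS1, mul_one, pow_one] at h1 h2
    rw [Matrix.mul_sub, trace_sub, ← pow_succ, h1, h2]
    simp only [mul_sub, Finset.sum_sub_distrib]
  have e2 : (A ^ (2 * k) * ((A - S * A * S) * (A - S * A * S))).trace
      = ∑ r, ∑ s, W r s * (μ r ^ (2 * k) * (μ r - μ s) ^ 2) := by
    have h1 := h (2 * k + 2) 0
    have h2 := h (2 * k + 1) 1
    have h3 := h (2 * k) 2
    simp only [pow_zero, hS1, mul_one, pow_one] at h1 h2 h3
    have hm : A ^ (2 * k) * ((A - S * A * S) * (A - S * A * S))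
        = A ^ (2 * k + 2) - A ^ (2 * k + 1) * (S * A * S)
          - A ^ (2 * k) * ((S * A * S) * A) + A ^ (2 * k) * (S * A ^ 2 * S) := by
      have : S * A ^ 2 * S = (S * A * S) * (S * A * S) := by
        rw [show S * A * S * (S * A * S) = S * A * (S * S) * A * S by
          simp only [Matrix.mul_assoc], hS1, sq]
        simp only [Matrix.mul_assoc, Matrix.mul_one]
      rw [this, pow_add, pow_add]
      noncomm_ring
    have hc : (A ^ (2 * k) * ((S * A * S) * A)).trace
        = (A ^ (2 * k + 1) * (S * A * S)).trace := by
      rw [← Matrix.mul_assoc, trace_mul_comm, ← Matrix.mul_assoc, ← pow_succ']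
    rw [hm, trace_add, trace_sub, trace_sub, hc, h1, h2, h3]
    simp only [← Finset.sum_sub_distrib, ← Finset.sum_add_distrib]
    refine Finset.sum_congr rfl fun r _ => Finset.sum_congr rfl fun s _ => ?_
    ring
  have d1 : 2 * ∑ r, ∑ s, W r s * (μ r ^ (2 * k + 2) - μ r ^ (2 * k + 1) * μ s)
      = ∑ r, ∑ s, W r s * ((μ r - μ s) * (μ r ^ (2 * k + 1) - μ s ^ (2 * k + 1))) := by
    rw [two_mul]
    nth_rewrite 2 [hsymm]
    simp only [← Finset.sum_add_distrib]
    refine Finset.sum_congr rfl fun r _ => Finset.sum_congr rfl fun s _ => ?_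
    ring
  have d2 : 2 * ∑ r, ∑ s, W r s * (μ r ^ (2 * k) * (μ r - μ s) ^ 2)
      = ∑ r, ∑ s, W r s * ((μ r - μ s) ^ 2 * (μ r ^ (2 * k) + μ s ^ (2 * k))) := by
    rw [two_mul]
    nth_rewrite 2 [hsymm]
    simp only [← Finset.sum_add_distrib]
    refine Finset.sum_congr rfl fun r _ => Finset.sum_congr rfl fun s _ => ?_
    ring
  have hle : 2 * ∑ r, ∑ s, W r s * ((μ r - μ s) * (μ r ^ (2 * k + 1) - μ s ^ (2 * k + 1)))
      ≤ (2 * k + 1) *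
        ∑ r, ∑ s, W r s * ((μ r - μ s) ^ 2 * (μ r ^ (2 * k) + μ s ^ (2 * k))) := by
    simp only [Finset.mul_sum]
    refine Finset.sum_le_sum fun r _ => Finset.sum_le_sum fun s _ => ?_
    nlinarith [mul_le_mul_of_nonneg_left (sub_mul_pow_sub_pow_le (μ r) (μ s) k) (hW r s)]
  rw [e1, e2]
  nlinarith

/-- A noncommutative Khintchine-type recursion for a sum of flips, each changing sign under a conjugation that
fixes the other summands. -/
theorem trace_pow_add_two_le {κ : Type*} [Fintype κ] {A : Matrix ι ι ℝ} (hA : A.IsHermitian)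
    (B S : κ → Matrix ι ι ℝ) (b : κ → ι → ℝ) {v : ℝ} (hsum : A = ∑ j, B j)
    (hS : ∀ j, (S j).IsHermitian) (hS1 : ∀ j, S j * S j = 1)
    (hSB : ∀ j, A - S j * A * S j = (2 : ℝ) • B j) (hB : ∀ j, B j * B j = diagonal (b j))
    (hb : ∀ x, ∑ j, b j x ≤ v) (k : ℕ) :
    (A ^ (2 * k + 2)).trace ≤ (2 * k + 1) * v * (A ^ (2 * k)).trace := by
  have hpos : ∀ x, 0 ≤ (A ^ (2 * k)) x x := by
    intro x
    have hk : (A ^ k).IsHermitian := hA.pow k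
    rw [two_mul, pow_add, mul_apply]
    refine Finset.sum_nonneg fun y _ => ?_
    have := hk.apply x y
    simp only [star_trivial] at this
    rw [this]
    exact mul_self_nonneg _
  have h1 : ∀ j, (A ^ (2 * k + 1) * B j).trace
      ≤ (2 * k + 1) * ∑ x, (A ^ (2 * k)) x x * b j x := by
    intro j
    -- With `A - S A S = 2B` the factors are `4` on the left and `4` on the right, so they cancel.
    have := two_mul_trace_pow_mul_sub_conj_le hA (hS j) (hS1 j) k
    rw [hSB, smul_mul_smul_comm, hB, Matrix.mul_smul, Matrix.mul_smul, trace_smul, trace_smul] at this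
    have ht : (A ^ (2 * k) * diagonal (b j)).trace = ∑ x, (A ^ (2 * k)) x x * b j x := by
      simp [trace, mul_diagonal]
    rw [ht] at this
    simp only [smul_eq_mul] at this
    linarith
  calc (A ^ (2 * k + 2)).trace = ∑ j, (A ^ (2 * k + 1) * B j).trace := by
        rw [show 2 * k + 2 = 2 * k + 1 + 1 by ring, pow_succ]
        nth_rewrite 2 [hsum]
        rw [Finset.mul_sum, trace_sum]
    _ ≤ ∑ j, (2 * k + 1) * ∑ x, (A ^ (2 * k)) x x * b j x := Finset.sum_le_sum fun j _ => h1 j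
    _ = (2 * k + 1) * ∑ x, (A ^ (2 * k)) x x * ∑ j, b j x := by
        rw [← Finset.mul_sum, Finset.sum_comm]
        simp only [Finset.mul_sum]
    _ ≤ (2 * k + 1) * ∑ x, (A ^ (2 * k)) x x * v := by
        gcongr with x
        · exact hpos x
        · exact hb x
    _ = _ := by rw [← Finset.sum_mul, trace]; simp only [diag_apply]; ring

/-! ### From traces to exponential moments of diagonal entries -/

/-- A diagonal entry of `G ^ k` is the mean of the `k`-th powers of the eigenvalues with probability
weights `‖O x r‖²`; this is Jensen's inequality. -/
theorem posSemidef_apply_self_pow_le {G : Matrix ι ι ℂ} (hG : G.PosSemidef) (x : ι) (k : ℕ) :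
    (G x x).re ^ k ≤ ((G ^ k) x x).re := by
  set O : Matrix ι ι ℂ := (hG.1.eigenvectorUnitary : Matrix ι ι ℂ) with hO
  set μ := hG.1.eigenvalues with hμ
  have hO1 : Oᴴ * O = 1 := (Unitary.mem_iff.1 hG.1.eigenvectorUnitary.2).1
  have hO2 : O * Oᴴ = 1 := mul_eq_one_comm.1 hO1
  have hGd : G = O * diagonal (fun r => (μ r : ℂ)) * Oᴴ := by
    have := hG.1.spectral_theorem
    rw [Unitary.conjStarAlgAut_apply] at this
    exact this
  have hpow : ∀ a : ℕ, G ^ a = O * diagonal (fun r => ((μ r ^ a : ℝ) : ℂ)) * Oᴴ := by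
    intro a
    induction a with
    | zero => simp [hO2]
    | succ a ih =>
      rw [pow_succ, ih]
      nth_rewrite 1 [hGd]
      calc O * diagonal (fun r => ((μ r ^ a : ℝ) : ℂ)) * Oᴴ * (O * diagonal (fun r => (μ r : ℂ)) * Oᴴ)
          = O * diagonal (fun r => ((μ r ^ a : ℝ) : ℂ)) * (Oᴴ * O)
            * diagonal (fun r => (μ r : ℂ)) * Oᴴ := by
            simp only [Matrix.mul_assoc]
        _ = _ := by
            rw [hO1, Matrix.mul_one, Matrix.mul_assoc O, diagonal_mul_diagonal]
            simp only [pow_succ, Complex.ofReal_mul]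
  have hent : ∀ a : ℕ, ((G ^ a) x x).re = ∑ r, ‖O x r‖ ^ 2 * μ r ^ a := by
    intro a
    rw [hpow, mul_apply, Complex.re_sum]
    refine Finset.sum_congr rfl fun r _ => ?_
    rw [mul_diagonal, conjTranspose_apply, mul_right_comm]
    have : O x r * star (O x r) = ((‖O x r‖ ^ 2 : ℝ) : ℂ) := by
      rw [Complex.star_def, Complex.mul_conj, Complex.normSq_eq_norm_sq]
    rw [this, ← Complex.ofReal_mul, Complex.ofReal_re]
  have h0 := hent 0
  have h1 := hent 1
  simp only [pow_zero, one_apply_eq, Complex.one_re, mul_one] at h0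
  simp only [pow_one] at h1
  rw [h1, hent]
  exact Real.pow_arith_mean_le_arith_mean_pow _ _ _ (fun r _ => by positivity) h0.symm
    (fun r _ => hG.eigenvalues_nonneg r) k

theorem norm_mul_conjTranspose_pow_apply_le {M : Matrix ι ι ℂ} {A : Matrix ι ι ℝ}
    (hA : A.IsHermitian) (hMA : ∀ x y, ‖M x y‖ ≤ A x y) (k : ℕ) (x y : ι) :
    ‖((M * Mᴴ) ^ k) x y‖ ≤ (A ^ (2 * k)) x y := by
  have hmul : ∀ {P Q : Matrix ι ι ℂ} {P' Q' : Matrix ι ι ℝ}, (∀ x y, ‖P x y‖ ≤ P' x y) →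
      (∀ x y, ‖Q x y‖ ≤ Q' x y) → ∀ x y, ‖(P * Q) x y‖ ≤ (P' * Q') x y := by
    intro P Q P' Q' hP hQ x y
    rw [mul_apply, mul_apply]
    refine (norm_sum_le _ _).trans (Finset.sum_le_sum fun z _ => ?_)
    rw [norm_mul]
    exact mul_le_mul (hP _ _) (hQ _ _) (norm_nonneg _) ((norm_nonneg _).trans (hP _ _))
  have hMA' : ∀ x y, ‖Mᴴ x y‖ ≤ A x y := by
    intro x y
    have := hA.apply x y
    simp only [star_trivial] at this
    rw [conjTranspose_apply, norm_star, ← this]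
    exact hMA y x
  induction k generalizing x y with
  | zero =>
    simp only [pow_zero, mul_zero, one_apply]
    split_ifs <;> simp
  | succ k ih =>
    rw [pow_succ, show 2 * (k + 1) = 2 * k + 2 by ring, pow_add, sq]
    exact hmul ih (hmul hMA hMA') x y

/-- With `T = U M Uᴴ`, `|T x x|²` is at most the diagonal entry of `T Tᴴ`; powers pass inside by
Jensen, and the resulting trace is unitarily invariant. -/
theorem sum_norm_diag_pow_le {U M : Matrix ι ι ℂ} {A : Matrix ι ι ℝ} (hU : U * Uᴴ = 1)
    (hA : A.IsHermitian) (hMA : ∀ x y, ‖M x y‖ ≤ A x y) (k : ℕ) :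
    ∑ x, ‖(U * M * Uᴴ) x x‖ ^ (2 * k) ≤ (A ^ (2 * k)).trace := by
  have hU' : Uᴴ * U = 1 := mul_eq_one_comm.1 hU
  set T := U * M * Uᴴ with hT
  have hG : (T * Tᴴ).PosSemidef := posSemidef_self_mul_conjTranspose T
  have h1 : ∀ x, ‖T x x‖ ^ 2 ≤ ((T * Tᴴ) x x).re := by
    intro x
    rw [mul_apply, Complex.re_sum]
    have : ∀ y, (T x y * Tᴴ y x).re = ‖T x y‖ ^ 2 := by
      intro y
      rw [conjTranspose_apply, Complex.star_def, Complex.mul_conj, Complex.normSq_eq_norm_sq,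
        Complex.ofReal_re]
    simp only [this]
    exact Finset.single_le_sum (f := fun y => ‖T x y‖ ^ 2) (fun y _ => by positivity)
      (Finset.mem_univ x)
  have h2 : (T * Tᴴ) ^ k = U * (M * Mᴴ) ^ k * Uᴴ := by
    have hTT : T * Tᴴ = U * (M * Mᴴ) * Uᴴ := by
      rw [hT]
      simp only [conjTranspose_mul, conjTranspose_conjTranspose]
      rw [show U * M * Uᴴ * (U * (Mᴴ * Uᴴ)) = U * M * (Uᴴ * U) * Mᴴ * Uᴴ by
        simp only [Matrix.mul_assoc], hU']
      simp only [Matrix.mul_assoc, Matrix.one_mul]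
    induction k with
    | zero => simp [hU]
    | succ k ih =>
      rw [pow_succ, ih, hTT, pow_succ]
      rw [show U * (M * Mᴴ) ^ k * Uᴴ * (U * (M * Mᴴ) * Uᴴ)
        = U * (M * Mᴴ) ^ k * (Uᴴ * U) * (M * Mᴴ) * Uᴴ by simp only [Matrix.mul_assoc], hU']
      simp only [Matrix.mul_assoc, Matrix.one_mul]
  have h3 : (((T * Tᴴ) ^ k).trace) = ((M * Mᴴ) ^ k).trace := by
    rw [h2, trace_mul_comm, ← Matrix.mul_assoc, hU', Matrix.one_mul]
  calc ∑ x, ‖T x x‖ ^ (2 * k) ≤ ∑ x, (((T * Tᴴ) ^ k) x x).re := by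
        refine Finset.sum_le_sum fun x _ => ?_
        rw [pow_mul]
        exact (pow_le_pow_left₀ (by positivity) (h1 x) k).trans
          (posSemidef_apply_self_pow_le hG x k)
    _ = (((M * Mᴴ) ^ k).trace).re := by
        rw [← h3, trace, Complex.re_sum]; rfl
    _ ≤ ∑ x, ‖((M * Mᴴ) ^ k) x x‖ := by
        rw [trace, Complex.re_sum]
        exact Finset.sum_le_sum fun x _ => Complex.re_le_norm _
    _ ≤ (A ^ (2 * k)).trace :=
        Finset.sum_le_sum fun x _ => norm_mul_conjTranspose_pow_apply_le hA hMA k x x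

/-- The recursion gives the Gaussian moments `t k ≤ N v^k (2k)!/(2^k k!)`, with `N` the cardinality,
so the series of `cosh` is dominated termwise by that of `N exp(l² v/2)`. -/
theorem sum_cosh_le_of_moments {ι : Type*} [Fintype ι] {h : ι → ℝ} {t : ℕ → ℝ} {v : ℝ} (hv : 0 ≤ v)
    (h0 : t 0 ≤ Fintype.card ι)
    (ht : ∀ k : ℕ, t (k + 1) ≤ (2 * k + 1) * v * t k)
    (hh : ∀ k, ∑ x, h x ^ (2 * k) ≤ t k) (l : ℝ) :
    ∑ x, Real.cosh (l * h x) ≤ Fintype.card ι * Real.exp (l ^ 2 * v / 2) := by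
  have hm : ∀ k : ℕ, t k * (2 ^ k * k.factorial) ≤ Fintype.card ι * v ^ k * (2 * k).factorial := by
    intro k
    induction k with
    | zero => simpa using h0
    | succ k ih =>
      have e : ((2 * (k + 1)).factorial : ℝ) = (2 * k + 2) * ((2 * k + 1) * (2 * k).factorial) := by
        rw [show 2 * (k + 1) = 2 * k + 1 + 1 by ring, Nat.factorial_succ, Nat.factorial_succ]
        push_cast; ring
      have e' : ((k + 1).factorial : ℝ) = (k + 1) * k.factorial := by
        rw [Nat.factorial_succ]; push_cast; ring
      rw [e, e']
      calc t (k + 1) * (2 ^ (k + 1) * ((k + 1) * k.factorial))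
          ≤ ((2 * k + 1) * v * t k) * (2 ^ (k + 1) * ((k + 1) * k.factorial)) := by
            gcongr; exact ht k
        _ = ((2 * k + 1) * v * (2 * k + 2)) * (t k * (2 ^ k * k.factorial)) := by ring
        _ ≤ ((2 * k + 1) * v * (2 * k + 2)) * (Fintype.card ι * v ^ k * (2 * k).factorial) := by
            gcongr
        _ = _ := by ring
  have s1 : HasSum (fun k : ℕ => ∑ x, (l * h x) ^ (2 * k) / (2 * k).factorial)
      (∑ x, Real.cosh (l * h x)) := hasSum_sum fun x _ => Real.hasSum_cosh _
  have s2 : HasSum (fun k : ℕ => Fintype.card ι * ((l ^ 2 * v / 2) ^ k / k.factorial))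
      (Fintype.card ι * Real.exp (l ^ 2 * v / 2)) := by
    have := NormedSpace.expSeries_div_hasSum_exp (l ^ 2 * v / 2)
    rw [← Real.exp_eq_exp_ℝ] at this
    exact this.mul_left _
  refine hasSum_le (fun k => ?_) s1 s2
  have hf : (0 : ℝ) < (2 * k).factorial := by positivity
  have hf' : (0 : ℝ) < k.factorial := by positivity
  calc ∑ x, (l * h x) ^ (2 * k) / (2 * k).factorial
      = l ^ (2 * k) * (∑ x, h x ^ (2 * k)) / (2 * k).factorial := by
        simp only [mul_pow, Finset.mul_sum, Finset.sum_div]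
    _ ≤ l ^ (2 * k) * t k / (2 * k).factorial := by
        have : 0 ≤ l ^ (2 * k) := (even_two_mul k).pow_nonneg l
        gcongr
        exact hh k
    _ ≤ _ := by
        have hl : 0 ≤ l ^ (2 * k) := (even_two_mul k).pow_nonneg l
        rw [div_le_iff₀ hf, div_pow, mul_pow, ← pow_mul]
        have := mul_le_mul_of_nonneg_left (hm k) hl
        rw [← sub_nonneg] at this ⊢
        have e : Fintype.card ι * (l ^ (2 * k) * v ^ k / 2 ^ k / k.factorial) * (2 * k).factorial
          - l ^ (2 * k) * t k = (l ^ (2 * k) * (Fintype.card ι * v ^ k * (2 * k).factorial)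
            - l ^ (2 * k) * (t k * (2 ^ k * k.factorial))) / (2 ^ k * k.factorial) := by
          field_simp
        rw [e]
        positivity

theorem sum_cosh_diag_le {κ : Type*} [Fintype κ] {U M : Matrix ι ι ℂ} {A : Matrix ι ι ℝ}
    (hU : U * Uᴴ = 1) (hMA : ∀ x y, ‖M x y‖ ≤ A x y) (hA : A.IsHermitian)
    (B S : κ → Matrix ι ι ℝ) (b : κ → ι → ℝ) {v : ℝ} (hv : 0 ≤ v) (hsum : A = ∑ j, B j)
    (hS : ∀ j, (S j).IsHermitian) (hS1 : ∀ j, S j * S j = 1)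
    (hSB : ∀ j, A - S j * A * S j = (2 : ℝ) • B j) (hB : ∀ j, B j * B j = diagonal (b j))
    (hb : ∀ x, ∑ j, b j x ≤ v) (l : ℝ) :
    ∑ x, Real.cosh (l * ‖(U * M * Uᴴ) x x‖) ≤ Fintype.card ι * Real.exp (l ^ 2 * v / 2) := by
  refine sum_cosh_le_of_moments (t := fun k => (A ^ (2 * k)).trace) hv (by simp) (fun k => ?_)
    (sum_norm_diag_pow_le hU hA hMA) l
  exact trace_pow_add_two_le hA B S b hsum hS hS1 hSB hB hb k

/-! ### Flip and rotation matrices on the cube -/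

theorem mul_signFlip_apply {n : ℕ} (x : Cube n) (j i : Fin n) :
    (x * signFlip j) i = if i = j then -x i else x i := by
  unfold signFlip
  by_cases h : i = j
  · subst h; simp
  · simp [h]

theorem mul_signFlip_mul_signFlip {n : ℕ} (x : Cube n) (j : Fin n) :
    x * signFlip j * signFlip j = x := by
  ext i
  simp only [mul_signFlip_apply]
  split_ifs <;> simp

theorem units_real_mul_self (a : ℤˣ) : (((a : ℤ) : ℝ)) * ((a : ℤ) : ℝ) = 1 := by
  rcases Int.units_eq_one_or a with h | h <;> simp [h]

theorem norm_partialDeriv_mul_signFlip {n : ℕ} (j : Fin n) (f : Cube n → ℂ) (x : Cube n) :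
    ‖partialDeriv j f (x * signFlip j)‖ = ‖partialDeriv j f x‖ := by
  unfold partialDeriv
  rw [mul_signFlip_mul_signFlip, norm_sub_rev]

theorem partialDeriv_walsh {n : ℕ} (j : Fin n) (A : Finset (Fin n)) (x : Cube n) :
    partialDeriv j (walsh A) x = if j ∈ A then 2 * walsh A x else 0 := by
  rw [partialDeriv, walsh_mul_signFlip]
  split_ifs <;> ring

theorem gradSup_nonneg {n : ℕ} (f : Cube n → ℂ) : 0 ≤ gradSup f :=
  Real.iSup_nonneg fun _ => Real.sqrt_nonneg _

theorem sum_norm_partialDeriv_sq_le {n : ℕ} (f : Cube n → ℂ) (x : Cube n) :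
    ∑ j, ‖partialDeriv j f x‖ ^ 2 ≤ gradSup f ^ 2 := by
  have h : gradLength f x ≤ gradSup f := le_ciSup (Set.finite_range (gradLength f)).bddAbove x
  have h0 : 0 ≤ ∑ j, ‖partialDeriv j f x‖ ^ 2 := by positivity
  calc ∑ j, ‖partialDeriv j f x‖ ^ 2 = gradLength f x ^ 2 := (Real.sq_sqrt h0).symm
    _ ≤ _ := pow_le_pow_left₀ (Real.sqrt_nonneg _) h 2

/-- The entries of the rotation of angle `θ / 2` in the plane of functions on `{-1, 1}`. -/
noncomputable def halfRotation (θ : ℝ) (a b : ℤˣ) : ℝ :=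
  if a = b then Real.cos (θ / 2) else ((a : ℤ) : ℝ) * Real.sin (θ / 2)

/-- The tensor power of the rotation of angle `θ / 2`. -/
noncomputable def rotationMatrix (n : ℕ) (θ : ℝ) : Matrix (Cube n) (Cube n) ℂ :=
  of fun x y => ∏ i, (halfRotation θ (x i) (y i) : ℂ)

/-- The fermionic partial derivative of `f` in the direction `j`: multiplication by `x_j ∂_j f / 2`
composed with the flip of the `j`-th coordinate. -/
noncomputable def flipMatrix {n : ℕ} (f : Cube n → ℂ) (j : Fin n) : Matrix (Cube n) (Cube n) ℂ :=
  of fun x y => if y = x * signFlip j then ((x j : ℤ) : ℂ) * partialDeriv j f x / 2 else 0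

/-- The entrywise absolute value of `flipMatrix f j`. -/
noncomputable def absFlipMatrix {n : ℕ} (f : Cube n → ℂ) (j : Fin n) : Matrix (Cube n) (Cube n) ℝ :=
  of fun x y => if y = x * signFlip j then ‖partialDeriv j f x‖ / 2 else 0

theorem sum_units {R : Type*} [AddCommMonoid R] (g : ℤˣ → R) : ∑ b, g b = g 1 + g (-1) := by
  rw [UnitsInt.univ, Finset.sum_pair (by decide)]

theorem sum_halfRotation_mul (θ : ℝ) (a a' : ℤˣ) :
    ∑ b, (halfRotation θ a b : ℂ) * halfRotation θ a' b = if a = a' then 1 else 0 := by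
  have h : ((Real.cos (θ / 2) : ℝ) : ℂ) ^ 2 + ((Real.sin (θ / 2) : ℝ) : ℂ) ^ 2 = 1 := by
    exact_mod_cast Real.cos_sq_add_sin_sq (θ / 2)
  have h1 : (1 : ℤˣ) ≠ -1 := by decide
  have h2 : (-1 : ℤˣ) ≠ 1 := by decide
  rw [sum_units]
  rcases Int.units_eq_one_or a with ha | ha <;> rcases Int.units_eq_one_or a' with ha' | ha' <;>
    subst ha ha' <;> simp only [halfRotation, h1, h2, if_true, if_false, Complex.ofReal_mul] <;>
    push_cast <;> push_cast at h <;> first | linear_combination h | ring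

theorem sum_units_mul_halfRotation_sq (θ : ℝ) (a : ℤˣ) :
    ∑ b : ℤˣ, ((b : ℤ) : ℂ) * ((halfRotation θ a b : ℂ) * halfRotation θ a b)
      = ((a : ℤ) : ℂ) * (Real.cos θ : ℂ) := by
  have h : Real.cos θ = Real.cos (θ / 2) ^ 2 - Real.sin (θ / 2) ^ 2 := by
    rw [← Real.cos_two_mul']; congr 1; ring
  have h1 : (1 : ℤˣ) ≠ -1 := by decide
  have h2 : (-1 : ℤˣ) ≠ 1 := by decide
  rw [sum_units, h]
  rcases Int.units_eq_one_or a with ha | ha <;>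
    subst ha <;> simp only [halfRotation, h1, h2, if_true, if_false, Complex.ofReal_mul] <;>
    push_cast <;> ring

theorem sum_halfRotation_mul_neg (θ : ℝ) (a : ℤˣ) :
    ∑ b : ℤˣ, (halfRotation θ a b : ℂ) * halfRotation θ a (-b)
      = ((a : ℤ) : ℂ) * (Real.sin θ : ℂ) := by
  have h : Real.sin θ = 2 * Real.sin (θ / 2) * Real.cos (θ / 2) := by
    rw [← Real.sin_two_mul]; congr 1; ring
  have h1 : (1 : ℤˣ) ≠ -1 := by decide
  have h2 : (-1 : ℤˣ) ≠ 1 := by decide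
  rw [sum_units, h]
  rcases Int.units_eq_one_or a with ha | ha <;>
    subst ha <;> simp only [halfRotation, h1, h2, if_true, if_false, Complex.ofReal_mul, neg_neg] <;>
    push_cast <;> ring

theorem rotationMatrix_mul_conjTranspose (n : ℕ) (θ : ℝ) :
    rotationMatrix n θ * (rotationMatrix n θ)ᴴ = 1 := by
  ext x y
  rw [mul_apply]
  have : ∀ z, rotationMatrix n θ x z * (rotationMatrix n θ)ᴴ z y
      = ∏ i, ((halfRotation θ (x i) (z i) : ℂ) * halfRotation θ (y i) (z i)) := by
    intro z
    rw [conjTranspose_apply, Finset.prod_mul_distrib]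
    simp only [rotationMatrix, of_apply, Complex.star_def, map_prod, Complex.conj_ofReal]
  simp only [this]
  rw [← Fintype.prod_sum (fun i b => (halfRotation θ (x i) b : ℂ) * halfRotation θ (y i) b)]
  simp only [sum_halfRotation_mul, one_apply]
  by_cases h : x = y
  · simp [h]
  · obtain ⟨i, hi⟩ := Function.ne_iff.1 h
    rw [if_neg h]
    exact Finset.prod_eq_zero (Finset.mem_univ i) (if_neg hi)

/-- The entry is a sum over the cube that factors over coordinates: coordinate `j` contributes `x_j
sin θ`, the other coordinates of `A` contribute `x_i cos θ`, the rest `1`. -/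
theorem rotation_flipMatrix_walsh_apply {n : ℕ} (θ : ℝ) (j : Fin n) (A : Finset (Fin n))
    (x : Cube n) :
    (rotationMatrix n θ * flipMatrix (walsh A) j * (rotationMatrix n θ)ᴴ) x x
      = if j ∈ A then (Real.sin θ : ℂ) * (Real.cos θ : ℂ) ^ (A.card - 1) * walsh A x else 0 := by
  have e1 : (rotationMatrix n θ * flipMatrix (walsh A) j * (rotationMatrix n θ)ᴴ) x x
      = ∑ y, rotationMatrix n θ x y * (((y j : ℤ) : ℂ) * partialDeriv j (walsh A) y / 2)
        * rotationMatrix n θ x (y * signFlip j) := by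
    rw [Matrix.mul_assoc, mul_apply]
    refine Finset.sum_congr rfl fun y _ => ?_
    rw [mul_apply, Finset.sum_eq_single (y * signFlip j)]
    · rw [flipMatrix, of_apply, if_pos rfl, conjTranspose_apply, mul_assoc]
      simp only [rotationMatrix, of_apply, Complex.star_def, map_prod, Complex.conj_ofReal]
    · intro z _ hz
      rw [flipMatrix, of_apply, if_neg hz, zero_mul]
    · simp
  rw [e1]
  by_cases hj : j ∈ A
  swap
  · simp [partialDeriv_walsh, hj]
  rw [if_pos hj]
  let g : Fin n → ℤˣ → ℂ := fun i b =>
    if i = j then (halfRotation θ (x i) b : ℂ) * halfRotation θ (x i) (-b)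
    else (if i ∈ A then ((b : ℤ) : ℂ) else 1)
      * ((halfRotation θ (x i) b : ℂ) * halfRotation θ (x i) b)
  have e2 : ∀ y : Cube n,
      rotationMatrix n θ x y * (((y j : ℤ) : ℂ) * partialDeriv j (walsh A) y / 2)
        * rotationMatrix n θ x (y * signFlip j) = ∏ i, g i (y i) := by
    intro y
    -- The sign `y_j` in `flipMatrix` cancels the `j`-th factor of `ω_A`, and the `1/2` cancels the
    -- `2` from `∂_j`.
    have hw : ((y j : ℤ) : ℂ) * partialDeriv j (walsh A) y / 2
        = ∏ i, (if i = j then 1 else if i ∈ A then ((y i : ℤ) : ℂ) else 1) := by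
      rw [partialDeriv_walsh, if_pos hj, walsh, ← Finset.mul_prod_erase _ _ hj]
      have hy : (((y j : ℤ) : ℂ)) * ((y j : ℤ) : ℂ) = 1 := by
        rcases Int.units_eq_one_or (y j) with h | h <;> simp [h]
      have : ∏ i, (if i = j then (1 : ℂ) else if i ∈ A then ((y i : ℤ) : ℂ) else 1)
          = ∏ i ∈ A.erase j, ((y i : ℤ) : ℂ) := by
        rw [← Finset.prod_filter_mul_prod_filter_not Finset.univ (· ∈ A.erase j)]
        rw [Finset.prod_eq_one (s := Finset.univ.filter (fun i => ¬ i ∈ A.erase j)), mul_one]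
        · refine Finset.prod_congr (by ext; simp) fun i hi => ?_
          rw [if_neg (Finset.ne_of_mem_erase hi), if_pos (Finset.mem_of_mem_erase hi)]
        · intro i hi
          by_cases h : i = j
          · simp [h]
          · simp only [Finset.mem_filter, Finset.mem_erase, Finset.mem_univ, true_and] at hi
            rw [if_neg h, if_neg fun h' => hi ⟨h, h'⟩]
      rw [this]
      linear_combination (∏ i ∈ A.erase j, ((y i : ℤ) : ℂ)) * hy
    rw [hw]
    simp only [rotationMatrix, of_apply, ← Finset.prod_mul_distrib]
    refine Finset.prod_congr rfl fun i _ => ?_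
    simp only [g, mul_signFlip_apply]
    split_ifs <;> ring
  simp only [e2]
  rw [← Fintype.prod_sum g]
  have e3 : ∀ i, ∑ b, g i b = if i = j then ((x i : ℤ) : ℂ) * (Real.sin θ : ℂ)
      else if i ∈ A then ((x i : ℤ) : ℂ) * (Real.cos θ : ℂ) else 1 := by
    intro i
    simp only [g]
    split_ifs
    · exact sum_halfRotation_mul_neg θ (x i)
    · exact sum_units_mul_halfRotation_sq θ (x i)
    · simp only [one_mul]
      rw [sum_halfRotation_mul, if_pos rfl]
  simp only [e3]
  have e4 : ∏ i, (if i = j then ((x i : ℤ) : ℂ) * (Real.sin θ : ℂ)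
      else if i ∈ A then ((x i : ℤ) : ℂ) * (Real.cos θ : ℂ) else 1)
      = ∏ i ∈ A, (((x i : ℤ) : ℂ) * if i = j then (Real.sin θ : ℂ) else (Real.cos θ : ℂ)) := by
    rw [← Finset.prod_subset (Finset.subset_univ A)]
    · refine Finset.prod_congr rfl fun i hi => ?_
      rw [if_pos hi]
      split_ifs <;> rfl
    · intro i _ hi
      rw [if_neg (fun h => hi (by rw [h]; exact hj)), if_neg hi]
  rw [e4, Finset.prod_mul_distrib, ← Finset.mul_prod_erase _ (fun i => if i = j then _ else _) hj,
    if_pos rfl, Finset.prod_congr rfl (fun i hi => if_neg (Finset.ne_of_mem_erase hi)),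
    Finset.prod_const, Finset.card_erase_of_mem hj, walsh]
  ring

theorem isHermitian_absFlipMatrix {n : ℕ} (f : Cube n → ℂ) (j : Fin n) :
    (absFlipMatrix f j).IsHermitian := by
  ext x y
  simp only [conjTranspose_apply, absFlipMatrix, of_apply, star_trivial]
  by_cases h : y = x * signFlip j
  · subst h
    rw [if_pos (mul_signFlip_mul_signFlip x j).symm, if_pos rfl, norm_partialDeriv_mul_signFlip]
  · rw [if_neg h, if_neg fun h' => h (by rw [h', mul_signFlip_mul_signFlip])]

theorem absFlipMatrix_mul_self {n : ℕ} (f : Cube n → ℂ) (j : Fin n) :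
    absFlipMatrix f j * absFlipMatrix f j
      = diagonal fun x => ‖partialDeriv j f x‖ ^ 2 / 4 := by
  ext x y
  rw [mul_apply, Finset.sum_eq_single (x * signFlip j)]
  · simp only [absFlipMatrix, of_apply, if_true, mul_signFlip_mul_signFlip, diagonal_apply,
      norm_partialDeriv_mul_signFlip]
    by_cases h : x = y
    · rw [if_pos h, if_pos h.symm]; ring
    · rw [if_neg h, if_neg (Ne.symm h), mul_zero]
  · intro z _ hz
    rw [absFlipMatrix, of_apply, if_neg hz, zero_mul]
  · simp

/-- Conjugation multiplies the `(x, y)` entry by `x_j y_j`, which is `-1` when `y` is the `j`-th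
flip of `x` and `1` for any other flip. -/
theorem sum_absFlipMatrix_sub_conj {n : ℕ} (f : Cube n → ℂ) (j : Fin n) :
    (∑ i, absFlipMatrix f i)
      - diagonal (fun x : Cube n => ((x j : ℤ) : ℝ)) * (∑ i, absFlipMatrix f i)
        * diagonal (fun x : Cube n => ((x j : ℤ) : ℝ)) = (2 : ℝ) • absFlipMatrix f j := by
  ext x y
  rw [Matrix.sub_apply, mul_diagonal, diagonal_mul, Matrix.smul_apply, Matrix.sum_apply,
    Finset.mul_sum, Finset.sum_mul, ← Finset.sum_sub_distrib, Finset.sum_eq_single j]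
  · simp only [absFlipMatrix, of_apply, smul_eq_mul]
    split_ifs with h
    · subst h
      rw [mul_signFlip_apply, if_pos rfl]
      push_cast
      linear_combination (‖partialDeriv j f x‖ / 2) * units_real_mul_self (x j)
    · ring
  · intro i _ hi
    simp only [absFlipMatrix, of_apply]
    split_ifs with h
    · subst h
      rw [mul_signFlip_apply, if_neg (Ne.symm hi)]
      linear_combination (-(‖partialDeriv i f x‖ / 2)) * units_real_mul_self (x j)
    · ring
  · simp

theorem sum_cosh_rotation_le {n : ℕ} (f : Cube n → ℂ) (θ l : ℝ) :
    ∑ x, Real.cosh (l * ‖(rotationMatrix n θ * (∑ j, flipMatrix f j) * (rotationMatrix n θ)ᴴ) x x‖)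
      ≤ Fintype.card (Cube n) * Real.exp (l ^ 2 * (gradSup f ^ 2 / 4) / 2) := by
  refine sum_cosh_diag_le (rotationMatrix_mul_conjTranspose n θ) (A := ∑ j, absFlipMatrix f j)
    (fun x y => ?_) ?_ (absFlipMatrix f) (fun j => diagonal fun x : Cube n => ((x j : ℤ) : ℝ))
    (fun j x => ‖partialDeriv j f x‖ ^ 2 / 4) (by positivity) rfl
    (fun j => isHermitian_diagonal _) (fun j => ?_) (sum_absFlipMatrix_sub_conj f)
    (absFlipMatrix_mul_self f) (fun x => ?_) l
  · rw [Matrix.sum_apply, Matrix.sum_apply]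
    refine (norm_sum_le _ _).trans (Finset.sum_le_sum fun j _ => ?_)
    simp only [flipMatrix, absFlipMatrix, of_apply]
    split_ifs
    · rcases Int.units_eq_one_or (x j) with h | h <;> simp [h]
    · simp
  · rw [IsHermitian, conjTranspose_sum]
    exact Finset.sum_congr rfl fun j _ => (isHermitian_absFlipMatrix f j).eq
  · rw [diagonal_mul_diagonal, ← diagonal_one]
    congr 1
    funext x
    exact units_real_mul_self (x j)
  · rw [← Finset.sum_div]
    exact div_le_div_of_nonneg_right (sum_norm_partialDeriv_sq_le f x) (by norm_num)

/-! ### Walsh expansion of the rotated diagonal -/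

theorem sum_walsh_mul_walsh {n : ℕ} (x y : Cube n) :
    ∑ A, walsh A x * walsh A y = if x = y then (Fintype.card (Cube n) : ℂ) else 0 := by
  have h1 : ∑ A, walsh A x * walsh A y
      = ∏ i, (1 + ((x i : ℤ) : ℂ) * ((y i : ℤ) : ℂ)) := by
    -- Expanding the product over subsets yields the Walsh kernel; a single coordinate with `x_i ≠
    -- y_i` makes it vanish.
    rw [Finset.prod_one_add, Finset.powerset_univ]
    simp only [walsh, Finset.prod_mul_distrib]
  rw [h1]
  by_cases h : x = y
  · subst h
    have : ∀ i, 1 + ((x i : ℤ) : ℂ) * ((x i : ℤ) : ℂ) = 2 := by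
      intro i
      rcases Int.units_eq_one_or (x i) with h | h <;> norm_num [h]
    simp [this]
  · rw [if_neg h]
    obtain ⟨i, hi⟩ := Function.ne_iff.1 h
    refine Finset.prod_eq_zero (Finset.mem_univ i) ?_
    rcases Int.units_eq_one_or (x i) with h1 | h1 <;>
      rcases Int.units_eq_one_or (y i) with h2 | h2 <;> simp [h1, h2] at hi ⊢

theorem prob_eq (n : ℕ) :
    prob n = ((Fintype.card (Cube n) : ENNReal)⁻¹) • Measure.count := by
  ext s _
  rw [prob, uniformOn_univ, Measure.smul_apply, smul_eq_mul, ENNReal.div_eq_inv_mul]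

theorem expect_eq {n : ℕ} (f : Cube n → ℂ) :
    expect f = (Fintype.card (Cube n) : ℂ)⁻¹ * ∑ x, f x := by
  rw [expect, prob_eq, integral_smul_measure, integral_count]
  simp

theorem sum_walshCoeff_mul_walsh {n : ℕ} (f : Cube n → ℂ) (x : Cube n) :
    ∑ A, walshCoeff f A * walsh A x = f x := by
  have hN : (Fintype.card (Cube n) : ℂ) ≠ 0 := Nat.cast_ne_zero.2 Fintype.card_ne_zero
  simp only [walshCoeff, expect_eq, mul_assoc, Finset.sum_mul]
  rw [← Finset.mul_sum, Finset.sum_comm]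
  simp only [← Finset.mul_sum, sum_walsh_mul_walsh]
  simp only [mul_ite, mul_zero, Finset.sum_ite_eq', Finset.mem_univ, if_true]
  field_simp

theorem flipMatrix_eq_sum_walsh {n : ℕ} (f : Cube n → ℂ) (j : Fin n) :
    flipMatrix f j = ∑ A, walshCoeff f A • flipMatrix (walsh A) j := by
  ext x y
  rw [Matrix.sum_apply]
  simp only [Matrix.smul_apply, flipMatrix, of_apply, smul_eq_mul]
  split_ifs
  · simp only [partialDeriv]
    conv_lhs => rw [← sum_walshCoeff_mul_walsh f x, ← sum_walshCoeff_mul_walsh f (x * signFlip j)]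
    rw [← Finset.sum_sub_distrib, Finset.mul_sum, Finset.sum_div]
    exact Finset.sum_congr rfl fun A _ => by ring
  · simp

theorem rotation_sum_flipMatrix_apply {n : ℕ} (f : Cube n → ℂ) (θ : ℝ) (x : Cube n) :
    (rotationMatrix n θ * (∑ j, flipMatrix f j) * (rotationMatrix n θ)ᴴ) x x
      = ∑ A : Finset (Fin n), ((A.card * Real.sin θ * Real.cos θ ^ (A.card - 1) : ℝ) : ℂ)
          * (walshCoeff f A * walsh A x) := by
  simp only [flipMatrix_eq_sum_walsh f]
  rw [Finset.sum_comm]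
  simp only [← Finset.smul_sum]
  rw [Finset.mul_sum, Finset.sum_mul, Matrix.sum_apply]
  refine Finset.sum_congr rfl fun A _ => ?_
  rw [Matrix.mul_smul, Matrix.smul_mul, Matrix.smul_apply, Finset.mul_sum, Finset.sum_mul,
    Matrix.sum_apply]
  simp only [rotation_flipMatrix_walsh_apply]
  rw [Finset.sum_ite_mem, Finset.univ_inter, Finset.sum_const, nsmul_eq_mul, smul_eq_mul]
  push_cast
  ring

/-! ### Averaging over the angle -/

theorem cosh_add_sinh_mul_le (a b : ℝ) :
    Real.cosh a + Real.sinh a * (b - a) ≤ Real.cosh b := by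
  have h1 : Real.exp a * (b - a + 1) ≤ Real.exp b := by
    rw [show b = a + (b - a) by ring, Real.exp_add]
    have := Real.add_one_le_exp (b - a)
    have e : a + (b - a) - a + 1 = b - a + 1 := by ring
    rw [e]
    gcongr
  have h2 : Real.exp (-a) * (-(b - a) + 1) ≤ Real.exp (-b) := by
    rw [show -b = -a + -(b - a) by ring, Real.exp_add]
    have := Real.add_one_le_exp (-(b - a))
    gcongr
  rw [Real.cosh_eq, Real.cosh_eq, Real.sinh_eq]
  nlinarith

/-- The eigenvalue on the Walsh functions of degree `a` of minus the derivative of the noise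
operator of parameter `cos θ`. -/
noncomputable def noiseDeriv (a : ℕ) (θ : ℝ) : ℝ := a * Real.sin θ * Real.cos θ ^ (a - 1)

theorem continuous_noiseDeriv (a : ℕ) : Continuous (noiseDeriv a) := by
  unfold noiseDeriv
  fun_prop

/-- Convexity transfers the bound on the derivatives of the noise semigroup to their averages. -/
theorem sum_cosh_multiplier_le {n : ℕ} (f : Cube n → ℂ) {w : ℝ → ℝ} {s : Set ℝ}
    (hs : IsCompact s) (hsm : MeasurableSet s)
    (hw : IntegrableOn w s) (hw0 : ∀ θ ∈ s, 0 ≤ w θ) (hW : 0 < ∫ θ in s, w θ) {l : ℝ}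
    (hl : 0 ≤ l) :
    ∑ x, Real.cosh (l * ‖∑ A : Finset (Fin n),
        ((∫ θ in s, w θ * noiseDeriv A.card θ : ℝ) : ℂ) * (walshCoeff f A * walsh A x)‖)
      ≤ Fintype.card (Cube n)
        * Real.exp (l ^ 2 * ((∫ θ in s, w θ) * (gradSup f / 2)) ^ 2 / 2) := by
  set W := ∫ θ in s, w θ with hWdef
  set H : ℝ → Cube n → ℂ := fun θ x => ∑ A : Finset (Fin n),
    (noiseDeriv A.card θ : ℂ) * (walshCoeff f A * walsh A x) with hH
  set F : Cube n → ℂ := fun x => ∑ A : Finset (Fin n),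
    ((∫ θ in s, w θ * noiseDeriv A.card θ : ℝ) : ℂ) * (walshCoeff f A * walsh A x) with hF
  set E := Fintype.card (Cube n) * Real.exp (l ^ 2 * (W * (gradSup f / 2)) ^ 2 / 2) with hE
  have hHc : ∀ x, Continuous fun θ => H θ x := by
    intro x
    refine continuous_finsetSum _ fun A _ => ?_
    exact (Complex.continuous_ofReal.comp (continuous_noiseDeriv _)).mul continuous_const
  have hi : ∀ x, IntegrableOn (fun θ => w θ * ‖H θ x‖) s := fun x =>
    hw.mul_continuousOn (hHc x).norm.continuousOn hs
  have hFi : ∀ x, ‖F x‖ ≤ ∫ θ in s, w θ * ‖H θ x‖ := by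
    intro x
    have e : F x = ∫ θ in s, (w θ : ℂ) * H θ x := by
      simp only [hF, hH, Finset.mul_sum]
      rw [integral_finsetSum]
      · refine Finset.sum_congr rfl fun A _ => ?_
        rw [← integral_complex_ofReal, ← integral_mul_const]
        refine integral_congr_ae (Filter.Eventually.of_forall fun θ => ?_)
        push_cast
        ring
      · intro A _
        have h1 : IntegrableOn (fun θ => w θ * noiseDeriv A.card θ) s :=
          hw.mul_continuousOn (continuous_noiseDeriv _).continuousOn hs
        have h2 := (h1.ofReal (𝕜 := ℂ)).mul_const (walshCoeff f A * walsh A x)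
        refine h2.congr (Filter.Eventually.of_forall fun θ => ?_)
        simp only [RCLike.ofReal_mul, Complex.coe_algebraMap, mul_assoc]
    rw [e]
    refine (norm_integral_le_integral_norm _).trans (le_of_eq ?_)
    refine setIntegral_congr_fun hsm fun θ hθ => ?_
    simp only [norm_mul, Complex.norm_real, Real.norm_eq_abs, abs_of_nonneg (hw0 θ hθ)]
  -- Tangent line of `cosh` at `l‖F x‖`, evaluated at `l W ‖H θ x‖`. Under the density `w / W` the
  -- latter averages to `l ∫ w ‖H‖ ≥ l‖F x‖`, so the linear term integrates to something
  -- nonnegative.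
  have hpt : ∀ θ, ∑ x, (Real.cosh (l * ‖F x‖)
      + Real.sinh (l * ‖F x‖) * (l * W * ‖H θ x‖ - l * ‖F x‖)) ≤ E := by
    intro θ
    refine (Finset.sum_le_sum fun x _ => cosh_add_sinh_mul_le _ _).trans ?_
    have := sum_cosh_rotation_le f θ (l * W)
    simp only [rotation_sum_flipMatrix_apply] at this
    refine this.trans (le_of_eq ?_)
    rw [hE]
    congr 2
    ring
  have hint : ∫ θ in s, w θ * ∑ x, (Real.cosh (l * ‖F x‖)
      + Real.sinh (l * ‖F x‖) * (l * W * ‖H θ x‖ - l * ‖F x‖)) ≤ ∫ θ in s, w θ * E := by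
    refine setIntegral_mono_on ?_ (hw.mul_const E) hsm fun θ hθ =>
      mul_le_mul_of_nonneg_left (hpt θ) (hw0 θ hθ)
    refine hw.mul_continuousOn (Continuous.continuousOn ?_) hs
    have := fun x => (hHc x).norm
    fun_prop
  have heq : ∫ θ in s, w θ * ∑ x, (Real.cosh (l * ‖F x‖)
      + Real.sinh (l * ‖F x‖) * (l * W * ‖H θ x‖ - l * ‖F x‖))
      = ∑ x, (W * Real.cosh (l * ‖F x‖) + Real.sinh (l * ‖F x‖) *
        (l * W * ((∫ θ in s, w θ * ‖H θ x‖) - ‖F x‖))) := by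
    have hterm : ∀ θ x, w θ * (Real.cosh (l * ‖F x‖)
        + Real.sinh (l * ‖F x‖) * (l * W * ‖H θ x‖ - l * ‖F x‖))
        = w θ * (Real.cosh (l * ‖F x‖) - Real.sinh (l * ‖F x‖) * (l * ‖F x‖))
          + w θ * ‖H θ x‖ * (Real.sinh (l * ‖F x‖) * (l * W)) := fun θ x => by ring
    simp only [Finset.mul_sum, hterm]
    rw [integral_finsetSum]
    · refine Finset.sum_congr rfl fun x _ => ?_
      rw [integral_add (hw.mul_const _) ((hi x).mul_const _), integral_mul_const,
        integral_mul_const, ← hWdef]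
      ring
    · exact fun x _ => (hw.mul_const _).add ((hi x).mul_const _)
  rw [heq, integral_mul_const, ← hWdef] at hint
  have hle : W * ∑ x, Real.cosh (l * ‖F x‖) ≤ W * E := by
    refine le_trans ?_ hint
    rw [Finset.mul_sum]
    refine Finset.sum_le_sum fun x _ => le_add_of_nonneg_right ?_
    have h1 : 0 ≤ Real.sinh (l * ‖F x‖) := Real.sinh_nonneg_iff.2 (by positivity)
    have h2 := sub_nonneg.2 (hFi x)
    positivity
  exact le_of_mul_le_mul_left hle hW

/-! ### Chernoff's bound -/

theorem prob_real_eq {n : ℕ} (s : Set (Cube n)) :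
    (prob n).real s = (Fintype.card (Cube n) : ℝ)⁻¹ * ∑ x, s.indicator 1 x := by
  rw [← integral_indicator_one s.toFinite.measurableSet, prob_eq, integral_smul_measure,
    integral_count]
  simp

theorem prob_tail_le {n : ℕ} {F : Cube n → ℝ} {v : ℝ}
    (h : ∀ l : ℝ, 0 ≤ l → ∑ x, Real.cosh (l * F x)
      ≤ Fintype.card (Cube n) * Real.exp (l ^ 2 * v ^ 2 / 2)) {t : ℝ} (ht : 0 < t) :
    (prob n).real {x | F x > t} ≤ 2 * Real.exp (-(t ^ 2 / (2 * v ^ 2))) ∧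
      (v = 0 → (prob n).real {x | F x > t} = 0) := by
  have hN : (0 : ℝ) < Fintype.card (Cube n) := Nat.cast_pos.2 Fintype.card_pos
  have hz : v = 0 → (prob n).real {x | F x > t} = 0 := by
    intro hv
    have hempty : {x | F x > t} = ∅ := by
      rw [Set.eq_empty_iff_forall_notMem]
      intro x hx
      -- For `v = 0` the `cosh` terms sum to at most their number; each is at least `1`, and
      -- strictly more where `F x > t`.
      have h1 := h 1 zero_le_one
      have h2 : ∑ x : Cube n, (1 : ℝ) < ∑ x, Real.cosh (1 * F x) := by
        refine Finset.sum_lt_sum (fun y _ => Real.one_le_cosh _) ⟨x, Finset.mem_univ x, ?_⟩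
        rw [one_mul]
        exact Real.one_lt_cosh.2 (ht.trans hx).ne'
      rw [hv] at h1
      simp at h1 h2
      linarith
    rw [hempty, measureReal_empty]
  refine ⟨?_, hz⟩
  by_cases hv : v = 0
  · rw [hz hv]; positivity
  -- The minimizer of `l² v²/2 - l t`. The factor `2` of the bound comes from `exp ≤ 2 cosh`.
  set l := t / v ^ 2 with hl
  have hv2 : 0 < v ^ 2 := by positivity
  have hl0 : 0 < l := div_pos ht hv2
  have h1 : (∑ x, {x | F x > t}.indicator (1 : Cube n → ℝ) x) * Real.exp (l * t)
      ≤ 2 * ∑ x, Real.cosh (l * F x) := by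
    rw [Finset.sum_mul, Finset.mul_sum]
    refine Finset.sum_le_sum fun x _ => ?_
    by_cases hx : F x > t
    · rw [Set.indicator_of_mem (by exact hx), Pi.one_apply, one_mul, Real.cosh_eq]
      have h2 : Real.exp (l * t) ≤ Real.exp (l * F x) :=
        Real.exp_le_exp.2 (mul_le_mul_of_nonneg_left hx.le hl0.le)
      have := Real.exp_pos (-(l * F x))
      linarith
    · rw [Set.indicator_of_notMem (by exact hx), zero_mul]
      have := Real.cosh_pos (l * F x)
      positivity
  have h2 := h l hl0.le
  rw [prob_real_eq, inv_mul_le_iff₀ hN]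
  have h3 : Real.exp (l ^ 2 * v ^ 2 / 2) = Real.exp (-(t ^ 2 / (2 * v ^ 2))) * Real.exp (l * t) := by
    rw [← Real.exp_add]
    congr 1
    rw [hl]
    field_simp
    ring
  rw [h3] at h2
  refine le_of_mul_le_mul_right ?_ (Real.exp_pos (l * t))
  linarith

/-! ### Integral representations of `f - 𝔼f` and `Δ^α f` -/

theorem integral_noiseDeriv {a : ℕ} (ha : a ≠ 0) :
    ∫ θ in Set.Icc 0 (Real.pi / 2), noiseDeriv a θ = 1 := by
  rw [integral_Icc_eq_integral_Ioc, ← intervalIntegral.integral_of_le (by positivity)]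
  have hd : ∀ θ ∈ Set.uIcc 0 (Real.pi / 2),
      HasDerivAt (fun θ => -Real.cos θ ^ a) (noiseDeriv a θ) θ := by
    intro θ _
    have := ((Real.hasDerivAt_cos θ).pow a).neg
    refine this.congr_deriv ?_
    unfold noiseDeriv
    ring
  rw [intervalIntegral.integral_eq_sub_of_hasDerivAt hd
    ((continuous_noiseDeriv a).intervalIntegrable _ _)]
  simp [ha]

theorem cos_pos_of_mem {θ : ℝ} (hθ : θ ∈ Set.Ioo 0 (Real.pi / 2)) : 0 < Real.cos θ :=
  Real.cos_pos_of_mem_Ioo ⟨by linarith [hθ.1, Real.pi_pos], hθ.2⟩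

theorem logCosPow_nonneg (α : ℝ) {θ : ℝ} (hθ : θ ∈ Set.Icc 0 (Real.pi / 2)) :
    0 ≤ logCosPow α θ := by
  have h : 0 ≤ Real.cos θ :=
    Real.cos_nonneg_of_mem_Icc ⟨by linarith [hθ.1, Real.pi_pos], hθ.2⟩
  exact Real.rpow_nonneg (neg_nonneg.2 (Real.log_nonpos h (Real.cos_le_one θ))) _

/-- `-log c ≥ 1 - c`, `1 - cos θ = 2 sin²(θ/2)`, and Jordan's inequality. Near `0` this bounds
`logCosPow α` by a multiple of `θ^{-2α}`, integrable because `2α < 1`. -/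
theorem two_div_pi_sq_mul_sq_le_neg_log_cos {θ : ℝ} (hθ : θ ∈ Set.Ioo 0 (Real.pi / 2)) :
    2 / Real.pi ^ 2 * θ ^ 2 ≤ -Real.log (Real.cos θ) := by
  have h1 : Real.log (Real.cos θ) ≤ Real.cos θ - 1 := Real.log_le_sub_one_of_pos (cos_pos_of_mem hθ)
  have h2 : 2 / Real.pi * (θ / 2) ≤ Real.sin (θ / 2) :=
    Real.mul_le_sin (by linarith [hθ.1]) (by linarith [hθ.2, Real.pi_pos])
  have h3 : Real.cos θ = 1 - 2 * Real.sin (θ / 2) ^ 2 := by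
    have := Real.cos_two_mul (θ / 2)
    rw [show 2 * (θ / 2) = θ by ring] at this
    linarith [Real.sin_sq_add_cos_sq (θ / 2)]
  have h4 : (2 / Real.pi * (θ / 2)) ^ 2 ≤ Real.sin (θ / 2) ^ 2 := by
    have := hθ.1
    have := Real.pi_pos
    exact pow_le_pow_left₀ (by positivity) h2 2
  have h5 : 2 / Real.pi ^ 2 * θ ^ 2 = 2 * (2 / Real.pi * (θ / 2)) ^ 2 := by
    field_simp
  linarith

theorem integrableOn_logCosPow {α : ℝ} (h0 : 0 < α) (h1 : α < 1 / 2) :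
    IntegrableOn (logCosPow α) (Set.Icc 0 (Real.pi / 2)) := by
  -- At both endpoints `logCosPow α` takes the default value `0` (`log 0 = 0` at `π/2`, `0 ^ (-α) =
  -- 0` at each); they form a null set.
  rw [integrableOn_Icc_iff_integrableOn_Ioo]
  have hg : IntegrableOn (fun θ : ℝ => (2 / Real.pi ^ 2) ^ (-α) * θ ^ (-(2 * α)))
      (Set.Ioo 0 (Real.pi / 2)) :=
    ((intervalIntegral.integrableOn_Ioo_rpow_iff (by positivity)).2 (by linarith)).const_mul _
  refine Integrable.mono' hg ?_ ?_
  · have : Measurable (logCosPow α) := by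
      unfold logCosPow
      fun_prop
    exact this.aestronglyMeasurable
  · refine (ae_restrict_iff' measurableSet_Ioo).2 (Filter.Eventually.of_forall fun θ hθ => ?_)
    rw [Real.norm_eq_abs, abs_of_nonneg (logCosPow_nonneg α (Set.Ioo_subset_Icc_self hθ))]
    have hθ0 := hθ.1
    have hp : 0 < 2 / Real.pi ^ 2 * θ ^ 2 := by positivity
    calc logCosPow α θ ≤ (2 / Real.pi ^ 2 * θ ^ 2) ^ (-α) :=
          Real.rpow_le_rpow_of_nonpos hp (two_div_pi_sq_mul_sq_le_neg_log_cos hθ) (by linarith)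
      _ = _ := by
          rw [Real.mul_rpow (by positivity) (by positivity), ← Real.rpow_natCast θ 2,
            ← Real.rpow_mul hθ0.le]
          congr 2
          push_cast
          ring

theorem integral_logCosPow_pos {α : ℝ} (h0 : 0 < α) (h1 : α < 1 / 2) :
    0 < ∫ θ in Set.Icc 0 (Real.pi / 2), logCosPow α θ := by
  rw [setIntegral_pos_iff_support_of_nonneg_ae ((ae_restrict_iff' measurableSet_Icc).2
    (Filter.Eventually.of_forall fun θ hθ => logCosPow_nonneg α hθ)) (integrableOn_logCosPow h0 h1)]
  have hsub : Set.Ioo 0 (Real.pi / 2) ⊆ Function.support (logCosPow α) ∩ Set.Icc 0 (Real.pi / 2) := by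
    intro θ hθ
    refine ⟨?_, Set.Ioo_subset_Icc_self hθ⟩
    have hθ0 := hθ.1
    have hp : 0 < 2 / Real.pi ^ 2 * θ ^ 2 := by positivity
    exact (Real.rpow_pos_of_pos (hp.trans_le (two_div_pi_sq_mul_sq_le_neg_log_cos hθ)) _).ne'
  refine lt_of_lt_of_le ?_ (measure_mono hsub)
  rw [Real.volume_Ioo]
  simp [Real.pi_pos]

theorem image_neg_log_cos :
    (fun θ => -Real.log (Real.cos θ)) '' Set.Ioo 0 (Real.pi / 2) = Set.Ioi 0 := by
  ext u
  constructor
  · rintro ⟨θ, hθ, rfl⟩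
    have hθ0 := hθ.1
    have hp : 0 < 2 / Real.pi ^ 2 * θ ^ 2 := by positivity
    exact hp.trans_le (two_div_pi_sq_mul_sq_le_neg_log_cos hθ)
  · intro hu
    have hu' : 0 < u := hu
    have h1 : Real.exp (-u) < 1 := Real.exp_lt_one_iff.2 (by linarith)
    have h2 := Real.exp_pos (-u)
    refine ⟨Real.arccos (Real.exp (-u)), ⟨Real.arccos_pos.2 h1, Real.arccos_lt_pi_div_two.2 h2⟩, ?_⟩
    simp only
    rw [Real.cos_arccos (by linarith) h1.le, Real.log_exp, neg_neg]

/-- The substitution `u = -log cos θ`, `du = tan θ dθ`, turns the integral into `a ∫ u^{-α} e^{-au}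
du`, a Gamma integral. -/
theorem integral_logCosPow_mul_noiseDeriv {α : ℝ} (h1 : α < 1) {a : ℕ} (ha : a ≠ 0) :
    ∫ θ in Set.Icc 0 (Real.pi / 2), logCosPow α θ * noiseDeriv a θ
      = Real.Gamma (1 - α) * (a : ℝ) ^ α := by
  have ha0 : (0 : ℝ) < a := Nat.cast_pos.2 (Nat.pos_of_ne_zero ha)
  have hcv := integral_image_eq_integral_abs_deriv_smul (s := Set.Ioo 0 (Real.pi / 2))
    (f := fun θ => -Real.log (Real.cos θ)) (f' := fun θ => Real.sin θ / Real.cos θ)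
    measurableSet_Ioo ?_ ?_ (fun u => u ^ (1 - α - 1) * Real.exp (-(a * u)))
  · rw [image_neg_log_cos, Real.integral_rpow_mul_exp_neg_mul_Ioi (by linarith) ha0] at hcv
    rw [integral_Icc_eq_integral_Ioo]
    have e : ∫ θ in Set.Ioo 0 (Real.pi / 2), logCosPow α θ * noiseDeriv a θ
        = a * ∫ θ in Set.Ioo 0 (Real.pi / 2), |Real.sin θ / Real.cos θ| •
          ((-Real.log (Real.cos θ)) ^ (1 - α - 1)
            * Real.exp (-(a * -Real.log (Real.cos θ)))) := by
      rw [← integral_const_mul]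
      refine setIntegral_congr_fun measurableSet_Ioo fun θ hθ => ?_
      have hc := cos_pos_of_mem hθ
      have hsn : 0 < Real.sin θ :=
        Real.sin_pos_of_pos_of_lt_pi hθ.1 (by linarith [hθ.2, Real.pi_pos])
      have hx : Real.exp (-(a * -Real.log (Real.cos θ))) = Real.cos θ ^ a := by
        rw [mul_neg, neg_neg, Real.exp_nat_mul, Real.exp_log hc]
      simp only [logCosPow, noiseDeriv]
      rw [hx, abs_of_pos (div_pos hsn hc), smul_eq_mul, show 1 - α - 1 = -α by ring]
      obtain ⟨b, rfl⟩ := Nat.exists_eq_succ_of_ne_zero ha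
      rw [Nat.succ_sub_one, pow_succ]
      field_simp
    rw [e, ← hcv, one_div, Real.inv_rpow ha0.le, ← Real.rpow_neg ha0.le]
    have : (a : ℝ) ^ α = a * (a : ℝ) ^ (-(1 - α)) := by
      nth_rewrite 2 [← Real.rpow_one (a : ℝ)]
      rw [← Real.rpow_add ha0]
      ring_nf
    rw [this]
    ring
  · intro θ hθ
    have := ((Real.hasDerivAt_cos θ).log (cos_pos_of_mem hθ).ne').neg
    exact (this.congr_deriv (by ring)).hasDerivWithinAt
  · intro x hx y hy hxy
    have h2 : Real.log (Real.cos x) = Real.log (Real.cos y) := neg_injective hxy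
    have h3 := Real.log_injOn_pos (cos_pos_of_mem hx) (cos_pos_of_mem hy) h2
    exact Real.injOn_cos ⟨hx.1.le, by linarith [hx.2, Real.pi_pos]⟩
      ⟨hy.1.le, by linarith [hy.2, Real.pi_pos]⟩ h3

/-- The integral is `1` for nonempty `A` and `0` for `A = ∅`, so exactly the mean is removed. -/
theorem sub_expect_eq {n : ℕ} (f : Cube n → ℂ) (x : Cube n) :
    f x - expect f = ∑ A : Finset (Fin n),
      ((∫ θ in Set.Icc 0 (Real.pi / 2), 1 * noiseDeriv A.card θ : ℝ) : ℂ)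
        * (walshCoeff f A * walsh A x) := by
  have h0 : expect f = walshCoeff f ∅ * walsh ∅ x := by simp [walshCoeff, walsh]
  conv_lhs => rw [← sum_walshCoeff_mul_walsh f x, h0]
  rw [← Finset.sum_erase_eq_sub (Finset.mem_univ ∅),
    ← Finset.add_sum_erase _ _ (Finset.mem_univ (∅ : Finset (Fin n)))]
  simp only [one_mul, Finset.card_empty]
  rw [show noiseDeriv 0 = 0 by funext θ; simp [noiseDeriv]]
  simp only [Pi.zero_apply, integral_zero, Complex.ofReal_zero, zero_mul, zero_add]
  refine Finset.sum_congr rfl fun A hA => ?_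
  have hA' : A.card ≠ 0 := Finset.card_ne_zero.2
    (Finset.nonempty_iff_ne_empty.2 (Finset.ne_of_mem_erase hA))
  rw [integral_noiseDeriv hA', Complex.ofReal_one, one_mul]

theorem laplacianPow_eq {n : ℕ} {α : ℝ} (h0 : 0 < α) (h1 : α < 1) (f : Cube n → ℂ) (x : Cube n) :
    laplacianPow α f x = ∑ A : Finset (Fin n),
      ((∫ θ in Set.Icc 0 (Real.pi / 2), (4 ^ α / Real.Gamma (1 - α) * logCosPow α θ)
        * noiseDeriv A.card θ : ℝ) : ℂ) * (walshCoeff f A * walsh A x) := by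
  have hG : 0 < Real.Gamma (1 - α) := Real.Gamma_pos_of_pos (by linarith)
  refine Finset.sum_congr rfl fun A _ => ?_
  rw [mul_assoc]
  congr 2
  simp only [mul_assoc]
  rw [integral_const_mul]
  by_cases hA : A.card = 0
  · rw [hA]
    simp [noiseDeriv, Real.zero_rpow h0.ne']
  · rw [integral_logCosPow_mul_noiseDeriv h1 hA, Real.mul_rpow (by norm_num) (by positivity)]
    field_simp

end DiscreteCube

/-! ### The two concentration inequalities -/

theorem corollary4p2 (n : ℕ) (f : Cube n → ℂ) :
    (∀ t : ℝ, 0 < t →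
      (prob n).real {x | ‖f x - expect f‖ > t}
          ≤ 2 * Real.exp (-(8 * t ^ 2 / (Real.pi ^ 2 * gradSup f ^ 2))) ∧
        (gradSup f = 0 → (prob n).real {x | ‖f x - expect f‖ > t} = 0)) ∧
    (∀ α : ℝ, 0 < α → α < 1 / 2 →
      IntegrableOn (logCosPow α) (Set.Icc 0 (Real.pi / 2)) volume ∧ 0 < constK α ∧
      ∀ t : ℝ, 0 < t →
        (prob n).real {x | ‖laplacianPow α f x‖ > t}
            ≤ 2 * Real.exp (-(t ^ 2 / (2 * constK α ^ 2 * gradSup f ^ 2))) ∧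
          (gradSup f = 0 → (prob n).real {x | ‖laplacianPow α f x‖ > t} = 0)) := by
  refine ⟨fun t ht => ?_, fun α h0 h1 => ?_⟩
  · have hW : ∫ _ in Set.Icc 0 (Real.pi / 2), (1 : ℝ) = Real.pi / 2 := by
      simp
      positivity
    -- Total weight `π/2` times standard deviation `gradSup f / 2`; then `2v² = π² (gradSup f)²/8`.
    have key := prob_tail_le (F := fun x => ‖f x - expect f‖) (v := Real.pi / 2 * (gradSup f / 2))
      (fun l hl => by
        have := sum_cosh_multiplier_le f (w := fun _ => 1) isCompact_Icc measurableSet_Icc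
          (integrableOn_const (by simp)) (fun _ _ => zero_le_one)
          (by rw [hW]; positivity) hl
        rw [hW] at this
        simpa only [sub_expect_eq] using this) ht
    refine ⟨?_, fun hg => key.2 (by rw [hg]; simp)⟩
    convert key.1 using 3
    have := Real.pi_pos
    by_cases hg : gradSup f = 0
    · simp [hg]
    · field_simp
      norm_num
  · have hG : 0 < Real.Gamma (1 - α) := Real.Gamma_pos_of_pos (by linarith)
    have hI := integral_logCosPow_pos h0 h1
    have hint := integrableOn_logCosPow h0 h1
    have hK : constK α
        = 1 / Real.Gamma (1 - α) * ∫ θ in Set.Icc 0 (Real.pi / 2), logCosPow α θ := by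
      rw [constK]
      congr 1
      exact setIntegral_congr_fun measurableSet_Icc fun θ hθ =>
        abs_of_nonneg (logCosPow_nonneg α hθ)
    have hK0 : 0 < constK α := by rw [hK]; positivity
    refine ⟨hint, hK0, fun t ht => ?_⟩
    have hW : ∫ θ in Set.Icc 0 (Real.pi / 2), 4 ^ α / Real.Gamma (1 - α) * logCosPow α θ
        = 4 ^ α * constK α := by
      rw [integral_const_mul, hK]
      ring
    -- The method gives `v = 4^α K_α gradSup f / 2`; `α < 1/2` bounds it by `K_α gradSup f`.
    have h4 : (4 : ℝ) ^ α ≤ 2 := by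
      calc (4 : ℝ) ^ α ≤ 4 ^ (1 / 2 : ℝ) :=
            Real.rpow_le_rpow_of_exponent_le (by norm_num) h1.le
        _ = 2 := by
            rw [← Real.sqrt_eq_rpow, show (4 : ℝ) = 2 ^ 2 by norm_num]
            exact Real.sqrt_sq (by norm_num)
    have h40 : (0 : ℝ) < 4 ^ α := by positivity
    have hg0 := gradSup_nonneg f
    have key := prob_tail_le (F := fun x => ‖laplacianPow α f x‖) (v := constK α * gradSup f)
      (fun l hl => by
        have := sum_cosh_multiplier_le f (w := fun θ => 4 ^ α / Real.Gamma (1 - α) * logCosPow α θ)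
          isCompact_Icc measurableSet_Icc (hint.const_mul _)
          (fun θ hθ => mul_nonneg (by positivity) (logCosPow_nonneg α hθ))
          (by rw [hW]; positivity) hl
        rw [hW] at this
        simp only [laplacianPow_eq h0 (by linarith : α < 1)]
        refine this.trans ?_
        have hle : 4 ^ α * constK α * (gradSup f / 2) ≤ constK α * gradSup f := by
          nlinarith [mul_nonneg hK0.le hg0]
        gcongr) ht
    refine ⟨?_, fun hg => key.2 (by rw [hg, mul_zero])⟩
    rw [mul_assoc 2, ← mul_pow]
    exact key.1
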